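/- \textbf{Theorem (Markov property of the mixture DAG).} \emph{Setting.} Let $V$ be a finite set and, for each $v\in V$, let $\mathcal X_v$ be a standard Borel space with a $\sigma$-finite reference measure $\mu_v$ (for instance Lebesgue measure on $\mathbb R$, or counting measure on a countable set). All densities are with respect to the product measure $\bigotimes_{v\in V}\mu_v$ on $\prod_{v\in V}\mathcal X_v$. Let $\mathcal D^{(1)},\dots,\mathcal D^{(K)}$ be directed acyclic graphs on the node set $V$, $\mathcal D^{(j)}=(V,E^{(j)})$, and write $\mathrm{pa}_j(v)$ for the parents of $v$ in $\mathcal D^{(j)}$. For each $j$ let $p^{(j)}$ be a probability density on $\prod_v\mathcal X_v$ that factorizes according to $\mathcal D^{(j)}$, i.e. $p^{(j)}(x_V)=\prod_{v\in V}p^{(j)}(x_v\mid x_{\mathrm{pa}_j(v)})$ almost everywhere, for some versions of the conditional densities of $p^{(j)}$. Here a version of the conditional density $p(x_v\mid x_S)$, $v\notin S$, is a nonnegative measurable function $f$ of $(x_v,x_S)$ with $\int f(x_v,x_S)\,d\mu_v(x_v)=1$ for all $x_S$ and $p(x_v,x_S)=f(x_v,x_S)\,p(x_S)$ almost everywhere,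 where $p(x_v,x_S)$ and $p(x_S)$ are marginal densities of $p$. Let $p_J$ be a probability distribution on $\{1,\dots,K\}$. The mixture distribution $p_\mu$ is the marginal in $x_V$ of the joint density $p_\mu(x_V,j)=p_J(j)\,p^{(j)}(x_V)$, that is, $p_\mu(x_V)=\sum_{j=1}^K p_J(j)\,p^{(j)}(x_V)$. A node $v$ is \emph{invariant}, $v\in V_{\mathrm{INV}}$, if its conditional density given its parents does not vary across the components: there is one function of $x_V$ that is, for every $j\in\{1,\dots,K\}$, a version of $p^{(j)}(x_v\mid x_{\mathrm{pa}_j(v)})$. The \emph{mixture DAG} $\mathcal D_\mu$ has $K|V|+1$ nodes: a copy $v^{(j)}$ of each $v\in V$ for each $j\in\{1,\dots,K\}$, and one further node $y$. Its edges are $u^{(j)}\to v^{(j)}$ for every $j$ and every edge $u\to v$ in $E^{(j)}$, and $y\to v^{(j)}$ for every $j$ and every $v\in V\setminus V_{\mathrm{INV}}$. For $A\subseteq V$ put $[A]=\{v^{(j)}: v\in A,\ 1\le j\le K\}$. In a DAG, a path (a sequence of distinct nodes, consecutive ones joined by an edge in either direction) is d-connecting given a set $Z$ of nodes if every collider on it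 is in $Z$ or has a descendant in $Z$, and no other interior node of it is in $Z$. Sets $S$ and $T$ of nodes are d-separated given $Z$ if no path between a node of $S$ and a node of $T$ is d-connecting given $Z$. \emph{Claim.} Let $A,B,C\subseteq V$ be pairwise disjoint. If $[A]$ and $[B]$ are d-separated given $[C]$ in the mixture DAG $\mathcal D_\mu$, then $X_A$ and $X_B$ are conditionally independent given $X_C$ when $X_V$ has the mixture distribution $p_\mu$. -/

import Mathlib

open MeasureTheory ProbabilityTheory
open scoped ENNReal

namespace MixtureDAG

/-! ### Directed acyclic graphs and d-separation -/

section Graph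

variable {W : Type*}

/-- A directed graph is a DAG if it has no directed cycle (in particular no self-loop). -/
def IsDAG (G : Digraph W) : Prop :=
  ∀ v, ¬ Relation.TransGen G.Adj v v

/-- The parents of `v` in `G`. -/
noncomputable def parents [Fintype W] (G : Digraph W) (v : W) : Finset W := by
  classical exact Finset.univ.filter (fun u => G.Adj u v)

/-- `c` is an ancestor of the set `Z`: some node of `Z` is `c` itself or a descendant of `c`. -/
def IsAncestorOf (G : Digraph W) (c : W) (Z : Set W) : Prop :=
  ∃ z ∈ Z, Relation.ReflTransGen G.Adj c z

/-- `u → c ← v`. -/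
def IsCollider (G : Digraph W) (u c v : W) : Prop :=
  G.Adj u c ∧ G.Adj v c

/-- A path (a walk without repeated nodes in the skeleton of `G`) is d-connecting given `Z` if
each collider on it is in `Z` or has a descendant in `Z`, and no other interior node of it lies
in `Z`. The interior nodes of `w` are `w.getVert (i + 1)` with `i + 2 ≤ w.length`. -/
def DConnecting (G : Digraph W) (Z : Set W) {a b : W}
    (w : G.toSimpleGraphInclusive.Walk a b) : Prop :=
  w.IsPath ∧ ∀ i, i + 2 ≤ w.length →
    (IsCollider G (w.getVert i) (w.getVert (i + 1)) (w.getVert (i + 2)) →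
      IsAncestorOf G (w.getVert (i + 1)) Z) ∧
    (¬ IsCollider G (w.getVert i) (w.getVert (i + 1)) (w.getVert (i + 2)) →
      w.getVert (i + 1) ∉ Z)

/-- `A` and `B` are d-separated given `Z` in `G`: no path between a node of `A` and a node of `B`
is d-connecting given `Z`. -/
def DSeparated (G : Digraph W) (A B Z : Set W) : Prop :=
  ∀ a ∈ A, ∀ b ∈ B, ∀ w : G.toSimpleGraphInclusive.Walk a b, ¬ DConnecting G Z w

end Graph

/-! ### Densities on a product space -/

section Density

variable {V : Type*} [Fintype V] [DecidableEq V] {X : V → Type*} [∀ v, MeasurableSpace (X v)]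

/-- A probability density on `∏ v, X v` with respect to the product of the reference measures. -/
structure ProbDensity (μ : ∀ v, Measure (X v)) where
  toFun : (∀ v, X v) → ℝ≥0∞
  measurable_toFun : Measurable toFun
  lintegral_eq_one : ∫⁻ x, toFun x ∂(Measure.pi μ) = 1

variable {μ : ∀ v, Measure (X v)}

/-- The distribution on `∏ v, X v` with density `p`. -/
noncomputable def ProbDensity.law (p : ProbDensity μ) : Measure (∀ v, X v) :=
  (Measure.pi μ).withDensity p.toFun

instance (p : ProbDensity μ) : IsProbabilityMeasure p.law :=
  ⟨by rw [ProbDensity.law, withDensity_apply _ MeasurableSet.univ, Measure.restrict_univ,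
    p.lintegral_eq_one]⟩

/-- The marginal density `p(x_S)`, seen as a function of the whole vector `x` that depends only on
the coordinates in `S`: the coordinates outside `S` are integrated out. -/
noncomputable def ProbDensity.marginal (p : ProbDensity μ) (S : Finset V) :
    (∀ v, X v) → ℝ≥0∞ :=
  lmarginal μ Sᶜ p.toFun

/-- `f` is a version of the conditional density `p(x_v | x_S)`, seen as a function of the whole
vector `x` that depends only on `x_v` and `x_S`. -/
structure IsCondDensity (p : ProbDensity μ) (v : V) (S : Finset V) (f : (∀ u, X u) → ℝ≥0∞) :
    Prop where
  measurable : Measurable f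
  dependsOn : DependsOn f (insert v (S : Set V))
  lintegral_eq_one : ∀ x, ∫⁻ t, f (Function.update x v t) ∂(μ v) = 1
  marginal_eq : ∀ᵐ x ∂(Measure.pi μ), p.marginal (insert v S) x = f x * p.marginal S x

/-- `p` factorizes according to `G`: `p(x) = ∏ v, p(x_v | x_pa(v))`. -/
def Factorizes (G : Digraph V) (p : ProbDensity μ) : Prop :=
  ∃ f : V → (∀ u, X u) → ℝ≥0∞,
    (∀ v, IsCondDensity p v (parents G v) (f v)) ∧
    ∀ᵐ x ∂(Measure.pi μ), p.toFun x = ∏ v, f v x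

/-! ### Mixtures and the mixture DAG -/

variable {K : ℕ}

/-- The joint density `p_μ(x, j) = p_J(j) p⁽ʲ⁾(x)`. -/
noncomputable def jointDensity (pJ : PMF (Fin K)) (p : Fin K → ProbDensity μ)
    (x : ∀ v, X v) (j : Fin K) : ℝ≥0∞ :=
  pJ j * (p j).toFun x

/-- The mixture distribution: the marginal of the joint density over the index variable. -/
noncomputable def mixture (pJ : PMF (Fin K)) (p : Fin K → ProbDensity μ) : ProbDensity μ where
  toFun x := ∑ j, jointDensity pJ p x j
  measurable_toFun :=
    Finset.measurable_sum _ fun j _ => (p j).measurable_toFun.const_mul _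
  lintegral_eq_one := by
    unfold jointDensity
    rw [lintegral_finsetSum _ fun j _ => (p j).measurable_toFun.const_mul _]
    simp_rw [lintegral_const_mul _ (p _).measurable_toFun, (p _).lintegral_eq_one, mul_one]
    exact (tsum_fintype (fun j => pJ j)).symm.trans pJ.tsum_coe

/-- The nodes whose conditional density given their parents does not vary across the components:
one and the same function is a version of `p⁽ʲ⁾(x_v | x_pa(v))` for all `j`. -/
def invariantNodes (D : Fin K → Digraph V) (p : Fin K → ProbDensity μ) : Set V :=
  {v | ∃ f : (∀ u, X u) → ℝ≥0∞, ∀ j, IsCondDensity (p j) v (parents (D j) v) f}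

/-- The nodes of the mixture DAG: `copy j v` is the copy of `v` in the `j`-th component, and `y`
is the additional node. -/
inductive Node (K : ℕ) (V : Type*) where
  | copy (j : Fin K) (v : V)
  | y

/-- The mixture DAG. -/
def mixtureDAG (D : Fin K → Digraph V) (p : Fin K → ProbDensity μ) : Digraph (Node K V) where
  Adj
    | .copy i u, .copy j v => i = j ∧ (D j).Adj u v
    | .y, .copy _ v => v ∉ invariantNodes D p
    | _, .y => False

/-- `[A]`, the set of all copies of the nodes in `A`. -/
def copies (K : ℕ) (A : Finset V) : Set (Node K V) :=
  {n | ∃ (j : Fin K) (v : V), v ∈ A ∧ n = .copy j v}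

/-- `X_A` and `X_B` are conditionally independent given `X_C` under the distribution `P`. -/
def CondIndepCoord [∀ v, StandardBorelSpace (X v)] (P : Measure (∀ v, X v)) [IsFiniteMeasure P]
    (A B C : Finset V) : Prop :=
  CondIndepFun (MeasurableSpace.comap (C.restrict (π := X)) inferInstance)
    (Finset.measurable_restrict C).comap_le (A.restrict (π := X)) (B.restrict (π := X)) P

end Density

end MixtureDAG

open MixtureDAG

/-! The graph side is moralization: if `[A]` and `[B]` are d-separated given `[C]`, then no chain
avoiding `[C]` joins them in the moralized ancestral graph of `[A] ∪ [B] ∪ [C]`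
(`DSeparated.not_moral`).

An invariant node has one conditional density serving all components. It depends only on the parents
common to all the graphs (`dependsOn_biInter`), so the other edges into that node may be deleted. In
the resulting `reducedGraph`s an invariant node has the same parents everywhere. Deleting edges
creates no moral chains, so `[A]` and `[B]` stay unjoined.

Hence `y` cannot be joined to both `[A]` and `[B]`; by symmetry suppose that it is not joined to
`[A]`. Every family met by the moral component of `[A]` then has an invariant child, since otherwise
`y` would lie in that family. So the component looks the same in every copy (`moralReach_copy`),
which yields a splitting (`exists_isSplitting`). In each component, the factors with child in `T`
are the same for all `j` and involve only `S ∪ C`, while the remaining ancestral factors avoid `S`.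

Integrating out everything but `x_C` gives the joint law of the events on `A`, `B`, `C` a density `H
s * G j t` in component `j`, where `H` does not depend on `j`. Averaging over `j` therefore keeps
the product form, and this is conditional independence (`condIndepFun_of_density`). -/

namespace MixtureDAG

/-! ### Active trails, d-separation and moral connectedness -/

section Trails

variable {W : Type*} {G : Digraph W} {Z : Set W}

/-- `f 0, …, f n` is a walk (possibly with repeated nodes) in the skeleton of `G` whose colliders
are ancestors of `Z` and whose other interior nodes are not in `Z`. -/
structure IsActiveTrail (G : Digraph W) (Z : Set W) (n : ℕ) (f : ℕ → W) : Prop where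
  adj : ∀ i < n, G.Adj (f i) (f (i + 1)) ∨ G.Adj (f (i + 1)) (f i)
  collider : ∀ i, i + 2 ≤ n → IsCollider G (f i) (f (i + 1)) (f (i + 2)) →
    IsAncestorOf G (f (i + 1)) Z
  noncollider : ∀ i, i + 2 ≤ n → ¬ IsCollider G (f i) (f (i + 1)) (f (i + 2)) → f (i + 1) ∉ Z

/-- Following a trail along its arrows from `f i`, one either meets a collider or never turns. -/
theorem IsActiveTrail.isAncestorOf_or_adj {n : ℕ} {f : ℕ → W} (h : IsActiveTrail G Z n f)
    {i j : ℕ} (hij : i ≤ j) (hj : j < n) (hi : G.Adj (f i) (f (i + 1))) :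
    IsAncestorOf G (f i) Z ∨
      (G.Adj (f j) (f (j + 1)) ∧ Relation.ReflTransGen G.Adj (f i) (f (j + 1))) := by
  induction j, hij using Nat.le_induction with
  | base => exact Or.inr ⟨hi, .single hi⟩
  | succ k hk ih =>
    rcases ih (by omega) with h1 | ⟨h1, h2⟩
    · exact Or.inl h1
    · by_cases h3 : G.Adj (f (k + 1 + 1)) (f (k + 1))
      · obtain ⟨z, hz, hcz⟩ := h.collider k (by omega) ⟨h1, h3⟩
        exact Or.inl ⟨z, hz, h2.trans hcz⟩
      · have h4 := (h.adj (k + 1) hj).resolve_right h3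
        exact Or.inr ⟨h4, h2.tail h4⟩

/-- A closed piece of an active trail can be cut out. -/
theorem IsActiveTrail.exists_lt_of_eq {n : ℕ} {f : ℕ → W} (h : IsActiveTrail G Z n f)
    {i j : ℕ} (hij : i < j) (hj : j ≤ n) (hf : f i = f j) :
    ∃ m < n, ∃ g : ℕ → W, IsActiveTrail G Z m g ∧ g 0 = f 0 ∧ g m = f n := by
  obtain ⟨d, rfl⟩ := Nat.exists_eq_add_of_lt hij
  set g : ℕ → W := fun k => if k ≤ i then f k else f (k + (d + 1)) with hg
  have g1 : ∀ k, k ≤ i → g k = f k := fun k hk => by simp [hg, hk]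
  have g2 : ∀ k, i ≤ k → g k = f (k + (d + 1)) := by
    intro k hk
    rcases hk.eq_or_lt with rfl | hk
    · rw [g1 _ le_rfl, hf]; rfl
    · simp [hg, not_le.mpr hk]
  -- Only the junction `f i = f j` has new neighbours. If it becomes a collider that was a collider
  -- at neither of its two visits, the removed loop leaves it along an arrow and does not return
  -- along one. The loop must then turn at a collider below it, so it is an ancestor of `Z`. If it
  -- becomes a non-collider, one of the two kept edges does not point into it, and the old triple
  -- with that edge already was a non-collider.
  have key : ∀ k, k + 2 ≤ n - (d + 1) → k + 1 = i →
      (IsCollider G (g k) (g (k + 1)) (g (k + 2)) → IsAncestorOf G (g (k + 1)) Z) ∧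
      (¬ IsCollider G (g k) (g (k + 1)) (g (k + 2)) → g (k + 1) ∉ Z) := by
    rintro k hk rfl
    have e1 := h.collider k (by omega)
    have e2 := h.noncollider k (by omega)
    have e3 := h.collider (k + d + 1) (by omega)
    have e4 := h.noncollider (k + d + 1) (by omega)
    have e5 := h.adj (k + 1) (by omega)
    have e6 := h.adj (k + d + 1) (by omega)
    have e7 := @IsActiveTrail.isAncestorOf_or_adj _ _ _ _ _ h (k + 1) (k + d + 1) (by omega)
      (by omega)
    rw [show k + 1 + d + 1 = k + d + 1 + 1 by omega] at hf
    rw [g1 k (by omega), g1 (k + 1) le_rfl, g2 (k + 2) (by omega),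
      show k + 2 + (d + 1) = k + d + 1 + 2 by omega]
    rw [← hf] at e3 e4 e6 e7
    unfold IsCollider at *
    constructor
    · rintro ⟨c1, c2⟩
      by_cases c3 : G.Adj (f (k + 2)) (f (k + 1))
      · exact e1 ⟨c1, c3⟩
      by_cases c4 : G.Adj (f (k + d + 1)) (f (k + 1))
      · exact e3 ⟨c4, c2⟩
      rcases e7 (e5.resolve_right c3) with h1 | ⟨h1, _⟩
      · exact h1
      · exact absurd h1 c4
    · intro hc
      by_cases c1 : G.Adj (f k) (f (k + 1))
      · exact e4 fun h' => hc ⟨c1, h'.2⟩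
      · exact e2 fun h' => c1 h'.1
  refine ⟨n - (d + 1), by omega, g, ⟨?_, ?_, ?_⟩, g1 0 (Nat.zero_le _), ?_⟩
  · intro k hk
    rcases lt_or_ge k i with hki | hki
    · rw [g1 k hki.le, g1 (k + 1) hki]
      exact h.adj k (by omega)
    · rw [g2 k hki, g2 (k + 1) (by omega), show k + 1 + (d + 1) = k + (d + 1) + 1 by omega]
      exact h.adj _ (by omega)
  · intro k hk
    rcases lt_trichotomy (k + 1) i with hki | hki | hki
    · rw [g1 k (by omega), g1 (k + 1) (by omega), g1 (k + 2) (by omega)]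
      exact h.collider k (by omega)
    · exact (key k hk hki).1
    · rw [g2 k (by omega), g2 (k + 1) (by omega), g2 (k + 2) (by omega),
        show k + 1 + (d + 1) = k + (d + 1) + 1 by omega,
        show k + 2 + (d + 1) = k + (d + 1) + 2 by omega]
      exact h.collider _ (by omega)
  · intro k hk
    rcases lt_trichotomy (k + 1) i with hki | hki | hki
    · rw [g1 k (by omega), g1 (k + 1) (by omega), g1 (k + 2) (by omega)]
      exact h.noncollider k (by omega)
    · exact (key k hk hki).2
    · rw [g2 k (by omega), g2 (k + 1) (by omega), g2 (k + 2) (by omega),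
        show k + 1 + (d + 1) = k + (d + 1) + 1 by omega,
        show k + 2 + (d + 1) = k + (d + 1) + 2 by omega]
      exact h.noncollider _ (by omega)
  · rw [g2 _ (by omega), show n - (d + 1) + (d + 1) = n by omega]

theorem IsActiveTrail.exists_injOn {n : ℕ} {f : ℕ → W} (h : IsActiveTrail G Z n f) :
    ∃ m, ∃ g : ℕ → W, IsActiveTrail G Z m g ∧ g 0 = f 0 ∧ g m = f n ∧
      Set.InjOn g {i | i ≤ m} := by
  induction n using Nat.strong_induction_on generalizing f with
  | _ n ih =>
    by_cases hinj : Set.InjOn f {i | i ≤ n}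
    · exact ⟨n, f, h, rfl, rfl, hinj⟩
    · have : ∃ i j, i < j ∧ j ≤ n ∧ f i = f j := by
        simp only [Set.InjOn, not_forall] at hinj
        obtain ⟨i, hi, j, hj, hij, hne⟩ := hinj
        rcases lt_or_gt_of_ne hne with hlt | hlt
        · exact ⟨i, j, hlt, hj, hij⟩
        · exact ⟨j, i, hlt, hi, hij.symm⟩
      obtain ⟨i, j, hij, hj, hf⟩ := this
      obtain ⟨m, hm, g, hg, hg0, hgm⟩ := h.exists_lt_of_eq hij hj hf
      obtain ⟨m', g', h1, h2, h3, h4⟩ := ih m hm hg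
      exact ⟨m', g', h1, h2.trans hg0, h3.trans hgm, h4⟩

theorem exists_walk_of_adj {H : SimpleGraph W} (n : ℕ) (f : ℕ → W)
    (h : ∀ i < n, H.Adj (f i) (f (i + 1))) :
    ∃ w : H.Walk (f 0) (f n), w.length = n ∧ ∀ k ≤ n, w.getVert k = f k := by
  induction n generalizing f with
  | zero => exact ⟨.nil, rfl, fun k hk => by simp [Nat.le_zero.mp hk]⟩
  | succ n ih =>
    obtain ⟨w, hw, hk⟩ := ih (fun k => f (k + 1)) fun i hi => h (i + 1) (by omega)
    refine ⟨.cons (h 0 (by omega)) w, by simp [hw], fun k hk' => ?_⟩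
    cases k with
    | zero => simp
    | succ k => simpa using hk k (by omega)

/-- Shortening makes trails with repeated nodes as good as paths, so later constructions may
concatenate freely. -/
theorem IsActiveTrail.not_dSeparated {A B : Set W} {n : ℕ} {f : ℕ → W}
    (h : IsActiveTrail G Z n f) (hA : f 0 ∈ A) (hB : f n ∈ B) : ¬ DSeparated G A B Z := by
  obtain ⟨m, g, hg, hg0, hgm, hinj⟩ := h.exists_injOn
  intro hsep
  obtain ⟨w, hw, hwg⟩ := @exists_walk_of_adj _ G.toSimpleGraphInclusive m g fun i hi =>
    ⟨fun he => by
      have := hinj (show i ≤ m by omega) (show i + 1 ≤ m by omega) he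
      omega, hg.adj i hi⟩
  refine hsep _ (hg0 ▸ hA) _ (hgm ▸ hB) w ⟨?_, fun i hi => ?_⟩
  · rw [← SimpleGraph.Walk.IsPath.getVert_injOn_iff, hw]
    intro a ha b hb hab
    rw [hwg a ha, hwg b hb] at hab
    exact hinj ha hb hab
  · rw [hw] at hi
    rw [hwg i (by omega), hwg (i + 1) (by omega), hwg (i + 2) (by omega)]
    exact ⟨hg.collider i hi, hg.noncollider i hi⟩

/-- The guards `1 ≤ n` matter: for `n = 0` the old end is not interior and `f (n - 1)` is just `f
0`. -/
theorem IsActiveTrail.snoc {n : ℕ} {f : ℕ → W} (h : IsActiveTrail G Z n f) {w : W}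
    (hadj : G.Adj (f n) w ∨ G.Adj w (f n))
    (hcol : 1 ≤ n → IsCollider G (f (n - 1)) (f n) w → IsAncestorOf G (f n) Z)
    (hnon : 1 ≤ n → ¬ IsCollider G (f (n - 1)) (f n) w → f n ∉ Z) :
    IsActiveTrail G Z (n + 1) (Function.update f (n + 1) w) := by
  have e : ∀ k ≤ n, Function.update f (n + 1) w k = f k := fun k hk =>
    Function.update_of_ne (by omega) _ _
  refine ⟨fun i hi => ?_, fun i hi => ?_, fun i hi => ?_⟩
  · rcases Nat.lt_succ_iff_lt_or_eq.mp hi with hi | rfl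
    · rw [e i (by omega), e (i + 1) (by omega)]
      exact h.adj i hi
    · rwa [e i le_rfl, Function.update_self]
  · rcases Nat.lt_or_ge n (i + 2) with hi' | hi'
    · obtain rfl : n = i + 1 := by omega
      rw [e i (by omega), e (i + 1) (by omega), Function.update_self]
      exact hcol (by omega)
    · rw [e i (by omega), e (i + 1) (by omega), e (i + 2) (by omega)]
      exact h.collider i hi'
  · rcases Nat.lt_or_ge n (i + 2) with hi' | hi'
    · obtain rfl : n = i + 1 := by omega
      rw [e i (by omega), e (i + 1) (by omega), Function.update_self]
      exact hnon (by omega)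
    · rw [e i (by omega), e (i + 1) (by omega), e (i + 2) (by omega)]
      exact h.noncollider i hi'

/-- `v` is the end of an active trail from `A` whose last edge, if any, points away from `v`. -/
def ReachTail (G : Digraph W) (A Z : Set W) (v : W) : Prop :=
  ∃ n f, IsActiveTrail G Z n f ∧ f 0 ∈ A ∧ f n = v ∧ (1 ≤ n → ¬ G.Adj (f (n - 1)) v)

/-- `v` is the end of an active trail from `A` whose last edge points towards `v`. -/
def ReachHead (G : Digraph W) (A Z : Set W) (v : W) : Prop :=
  ∃ n f, IsActiveTrail G Z n f ∧ f 0 ∈ A ∧ f n = v ∧ 1 ≤ n ∧ G.Adj (f (n - 1)) v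

variable {A B : Set W} {u v w : W}

theorem reachTail_of_mem (h : v ∈ A) : ReachTail G A Z v :=
  ⟨0, fun _ => v, ⟨by simp, by simp, by simp⟩, h, rfl, by simp⟩

/-- First of four moves. Only arriving by a head and leaving to a parent makes a collider, which
must be an ancestor of `Z`; the other three moves need `v ∉ Z`. -/
theorem ReachTail.parent (hG : ∀ u v, G.Adj u v → ¬ G.Adj v u) (h : ReachTail G A Z v)
    (hv : v ∉ Z) (huv : G.Adj u v) : ReachTail G A Z u := by
  obtain ⟨n, f, hf, h0, rfl, hn⟩ := h
  refine ⟨n + 1, _, hf.snoc (Or.inr huv) (fun h1 h2 => absurd h2.1 (hn h1)) fun _ _ => hv,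
    ?_, Function.update_self .., fun _ => ?_⟩
  · rwa [Function.update_of_ne (by omega)]
  · rw [Nat.add_sub_cancel, Function.update_of_ne (by omega)]
    exact hG _ _ huv

theorem ReachTail.child (h : ReachTail G A Z v) (hv : v ∉ Z) (hvw : G.Adj v w) :
    ReachHead G A Z w := by
  obtain ⟨n, f, hf, h0, rfl, hn⟩ := h
  refine ⟨n + 1, _, hf.snoc (Or.inl hvw) (fun h1 h2 => absurd h2.1 (hn h1)) fun _ _ => hv,
    ?_, Function.update_self .., by omega, ?_⟩
  · rwa [Function.update_of_ne (by omega)]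
  · rwa [Nat.add_sub_cancel, Function.update_of_ne (by omega)]

theorem ReachHead.child (hG : ∀ u v, G.Adj u v → ¬ G.Adj v u) (h : ReachHead G A Z v)
    (hv : v ∉ Z) (hvw : G.Adj v w) : ReachHead G A Z w := by
  obtain ⟨n, f, hf, h0, rfl, hn, hn'⟩ := h
  refine ⟨n + 1, _, hf.snoc (Or.inl hvw) (fun _ h2 => absurd h2.2 (hG _ _ hvw)) fun _ _ => hv,
    ?_, Function.update_self .., by omega, ?_⟩
  · rwa [Function.update_of_ne (by omega)]
  · rwa [Nat.add_sub_cancel, Function.update_of_ne (by omega)]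

theorem ReachHead.parent (hG : ∀ u v, G.Adj u v → ¬ G.Adj v u) (h : ReachHead G A Z v)
    (hv : IsAncestorOf G v Z) (huv : G.Adj u v) : ReachTail G A Z u := by
  obtain ⟨n, f, hf, h0, rfl, hn, hn'⟩ := h
  refine ⟨n + 1, _, hf.snoc (Or.inr huv) (fun _ _ => hv)
    (fun _ h2 => absurd ⟨hn', huv⟩ h2), ?_, Function.update_self .., fun _ => ?_⟩
  · rwa [Function.update_of_ne (by omega)]
  · rw [Nat.add_sub_cancel, Function.update_of_ne (by omega)]
    exact hG _ _ huv

theorem DSeparated.not_reach (hsep : DSeparated G A B Z) (hv : v ∈ B) :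
    ¬ (ReachTail G A Z v ∨ ReachHead G A Z v) := by
  rintro (⟨n, f, hf, h0, rfl, -⟩ | ⟨n, f, hf, h0, rfl, -⟩) <;>
    exact hf.not_dSeparated h0 hv hsep

/-- A head-on arrival at an ancestor of `A ∪ B ∪ Z` can be continued to a parent. -/
theorem ReachHead.parent_of_isAncestorOf (hG : ∀ u v, G.Adj u v → ¬ G.Adj v u)
    (hsep : DSeparated G A B Z) (h : ReachHead G A Z v)
    (hv : IsAncestorOf G v (A ∪ B ∪ Z)) (huv : G.Adj u v) : ReachTail G A Z u := by
  by_cases hZ : IsAncestorOf G v Z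
  · exact h.parent hG hZ huv
  -- Directed paths from `v` are now unblocked. If one ends in `A`, a fresh trail can start there
  -- and climb to `v`, arriving by a tail; if one ends in `B`, descending it contradicts the
  -- separation.
  have hvZ : ∀ x, Relation.ReflTransGen G.Adj v x → x ∉ Z := fun x hx hxZ => hZ ⟨x, hxZ, hx⟩
  obtain ⟨x, (hxA | hxB) | hxZ, hx⟩ := hv
  · clear h hZ
    have : ReachTail G A Z v := by
      clear huv
      induction hx using Relation.ReflTransGen.head_induction_on with
      | refl => exact reachTail_of_mem hxA
      | head h1 h2 ih =>
        exact (ih fun y hy => hvZ y (.head h1 hy)).parent hG (hvZ _ (.single h1)) h1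
    exact this.parent hG (hvZ v .refl) huv
  · have : ReachHead G A Z x := by
      clear hxB
      induction hx with
      | refl => exact h
      | tail h1 h2 ih => exact ih.child hG (hvZ _ h1) h2
    exact absurd (Or.inr this) (hsep.not_reach hxB)
  · exact absurd hxZ (hvZ x hx)

/-- `u` and `w` lie outside `Z` and belong to a common family `{c} ∪ pa(c)`, where `c` is an
ancestor of `T`: they are equal or adjacent in the moralized ancestral graph. -/
def Moral (G : Digraph W) (T Z : Set W) (u w : W) : Prop :=
  u ∉ Z ∧ w ∉ Z ∧ ∃ c, IsAncestorOf G c T ∧ (u = c ∨ G.Adj u c) ∧ (w = c ∨ G.Adj w c)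

theorem Moral.symm {T : Set W} (h : Moral G T Z u w) : Moral G T Z w u :=
  let ⟨h1, h2, c, hc, h3, h4⟩ := h
  ⟨h2, h1, c, hc, h4, h3⟩

theorem IsAncestorOf.mono {G' : Digraph W} (hle : ∀ u v, G'.Adj u v → G.Adj u v) {T : Set W}
    (h : IsAncestorOf G' u T) : IsAncestorOf G u T :=
  let ⟨z, hz, hu⟩ := h
  ⟨z, hz, Relation.ReflTransGen.mono hle _ _ hu⟩

theorem Moral.mono {G' : Digraph W} (hle : ∀ u v, G'.Adj u v → G.Adj u v) {T : Set W}
    (h : Moral G' T Z u w) : Moral G T Z u w :=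
  let ⟨h1, h2, c, hc, h3, h4⟩ := h
  ⟨h1, h2, c, hc.mono hle, h3.imp_right (hle _ _), h4.imp_right (hle _ _)⟩

/-- Each moral step is imitated by active trails inside its family. Two parents are joined through
their child `c`, which is entered by a head and left to a parent; this is where `c` must be an
ancestor of `A ∪ B ∪ Z`. -/
theorem DSeparated.not_moral (hG : ∀ u v, G.Adj u v → ¬ G.Adj v u) (hsep : DSeparated G A B Z)
    {a b : W} (ha : a ∈ A) (hb : b ∈ B) :
    ¬ Relation.ReflTransGen (Moral G (A ∪ B ∪ Z) Z) a b := by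
  intro hab
  refine hsep.not_reach hb ?_
  clear hb
  induction hab with
  | refl => exact Or.inl (reachTail_of_mem ha)
  | tail _ hm ih =>
    obtain ⟨h1, h2, c, hc, rfl | h3, rfl | h4⟩ := hm
    · exact ih
    · rcases ih with ih | ih
      · exact Or.inl (ih.parent hG h1 h4)
      · exact Or.inl (ih.parent_of_isAncestorOf hG hsep hc h4)
    · rcases ih with ih | ih
      · exact Or.inr (ih.child h1 h3)
      · exact Or.inr (ih.child hG h1 h3)
    · refine Or.inl (ReachHead.parent_of_isAncestorOf hG hsep ?_ hc h4)
      rcases ih with ih | ih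
      · exact ih.child h1 h3
      · exact ih.child hG h1 h3

end Trails

/-! ### Splitting the ancestral graph of a union of DAGs with an additional source -/

section Splitting

variable {V : Type*} {K : ℕ}

/-- The disjoint union of the graphs `E j`, with an additional node `y` pointing to the copies of
the nodes outside `I`. -/
def unionGraph (E : Fin K → Digraph V) (I : Set V) : Digraph (Node K V) where
  Adj
    | .copy i u, .copy j v => i = j ∧ (E j).Adj u v
    | .y, .copy _ v => v ∉ I
    | _, .y => False

/-- `N j` is an ancestral set of `E j` containing `A ∪ B ∪ C`, and each family in it is contained
in `S ∪ C`, if its child lies in `T`, and disjoint from `S` otherwise, where `A ⊆ S`, `B ∩ S = ∅`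
and `T` consists of nodes in `I`. -/
structure IsSplitting (E : Fin K → Digraph V) (I : Set V) (A B C S T : Finset V)
    (N : Fin K → Finset V) : Prop where
  subset_left : ∀ j, A ⊆ N j
  subset_right : ∀ j, B ⊆ N j
  subset_cond : ∀ j, C ⊆ N j
  parent_mem : ∀ j u v, v ∈ N j → (E j).Adj u v → u ∈ N j
  side_subset : ∀ j, S ⊆ N j
  child_subset : ∀ j, T ⊆ N j
  left_subset : A ⊆ S
  disjoint_right : Disjoint S B
  disjoint_cond : Disjoint S C
  invariant : ∀ v ∈ T, v ∈ I
  child_mem : ∀ v ∈ T, v ∈ S ∨ v ∈ C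
  child_parent_mem : ∀ j, ∀ v ∈ T, ∀ u, (E j).Adj u v → u ∈ S ∨ u ∈ C
  notMem_side : ∀ j, ∀ v ∈ N j, v ∉ T → v ∉ S
  parent_notMem_side : ∀ j, ∀ v ∈ N j, v ∉ T → ∀ u, (E j).Adj u v → u ∉ S

variable {E : Fin K → Digraph V} {I : Set V} {A B C : Finset V}

@[simp] theorem copy_mem_copies {j : Fin K} {v : V} : Node.copy j v ∈ copies K A ↔ v ∈ A := by
  simp [copies]

@[simp] theorem y_notMem_copies : (Node.y : Node K V) ∉ copies K A := by
  simp [copies]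

@[simp] theorem unionGraph_adj_copy {i j : Fin K} {u v : V} :
    (unionGraph E I).Adj (.copy i u) (.copy j v) ↔ i = j ∧ (E j).Adj u v := Iff.rfl

@[simp] theorem unionGraph_adj_y_copy {j : Fin K} {v : V} :
    (unionGraph E I).Adj .y (.copy j v) ↔ v ∉ I := Iff.rfl

@[simp] theorem unionGraph_not_adj_y {n : Node K V} : ¬ (unionGraph E I).Adj n .y := by
  cases n <;> exact id

theorem IsAncestorOf.parent {W : Type*} {G : Digraph W} {u v : W} {T : Set W}
    (h : IsAncestorOf G v T) (huv : G.Adj u v) : IsAncestorOf G u T :=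
  let ⟨z, hz, hv⟩ := h
  ⟨z, hz, .head huv hv⟩

/-- `n` is joined to `A` in the moralized ancestral graph of `T` by a chain avoiding `Z`. -/
def MoralReach {W : Type*} (G : Digraph W) (A T Z : Set W) (n : W) : Prop :=
  ∃ a ∈ A, Relation.ReflTransGen (Moral G T Z) a n

section MoralReach

variable {W : Type*} {G : Digraph W} {A T Z : Set W} {n m c : W}

theorem MoralReach.notMem (h : MoralReach G A T Z n) (hAZ : ∀ a ∈ A, a ∉ Z) : n ∉ Z := by
  obtain ⟨a, ha, h⟩ := h
  cases h with
  | refl => exact hAZ _ ha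
  | tail _ h => exact h.2.1

theorem MoralReach.isAncestorOf (h : MoralReach G A T Z n) (hAT : A ⊆ T) :
    IsAncestorOf G n T := by
  obtain ⟨a, ha, h⟩ := h
  cases h with
  | refl => exact ⟨_, hAT ha, .refl⟩
  | tail _ h =>
    obtain ⟨-, -, c, hc, -, rfl | h⟩ := h
    · exact hc
    · exact hc.parent h

theorem MoralReach.family (h : MoralReach G A T Z n) (hAZ : ∀ a ∈ A, a ∉ Z)
    (hc : IsAncestorOf G c T) (hn : n = c ∨ G.Adj n c) (hm : m = c ∨ G.Adj m c) (hmZ : m ∉ Z) :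
    MoralReach G A T Z m :=
  let ⟨a, ha, h'⟩ := h
  ⟨a, ha, h'.tail ⟨h.notMem hAZ, hmZ, c, hc, hn, hm⟩⟩

end MoralReach

section

variable {T : Set (Node K V)}

theorem notMem_copies_of_mem (hAC : Disjoint A C) : ∀ a ∈ copies K A, a ∉ copies K C := by
  rintro _ ⟨j, v, hv, rfl⟩
  simpa using Finset.disjoint_left.mp hAC hv

/-- Otherwise `y` is a parent of `c`, hence in a family already reached, and `y` is never in `[C]`.
-/
theorem mem_of_moralReach
    (hAC : Disjoint A C)
    (hy : ¬ MoralReach (unionGraph E I) (copies K A) T (copies K C) .y)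
    {i : Fin K} {c : V} {n : Node K V}
    (hn : MoralReach (unionGraph E I) (copies K A) T (copies K C) n)
    (hc : IsAncestorOf (unionGraph E I) (.copy i c) T)
    (hnc : n = .copy i c ∨ (unionGraph E I).Adj n (.copy i c)) : c ∈ I := by
  by_contra hcI
  exact hy (hn.family (notMem_copies_of_mem hAC) hc hnc (Or.inr (by simpa using hcI)) (by simp))

/-- A directed path down to `T` stays reached until it meets `C`, so the children along it lie in
`I` and its edges exist in every copy. Meeting `C` ends the argument because `[C] ⊆ T`. -/
theorem isAncestorOf_copy (hI : ∀ v ∈ I, ∀ i j u, (E i).Adj u v → (E j).Adj u v)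
    (hAC : Disjoint A C)
    (hy : ¬ MoralReach (unionGraph E I) (copies K A) T (copies K C) .y)
    (hT : ∀ i j v, Node.copy i v ∈ T → Node.copy j v ∈ T) (hCT : copies K C ⊆ T)
    {i : Fin K} (j : Fin K) {c : V} {n : Node K V}
    (hn : MoralReach (unionGraph E I) (copies K A) T (copies K C) n)
    (hc : IsAncestorOf (unionGraph E I) (.copy i c) T)
    (hnc : n = .copy i c ∨ (unionGraph E I).Adj n (.copy i c)) :
    IsAncestorOf (unionGraph E I) (.copy j c) T := by
  obtain ⟨z, hz, hcz⟩ := hc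
  generalize hx : Node.copy i c = x at hcz
  induction hcz using Relation.ReflTransGen.head_induction_on generalizing c n with
  | refl =>
    subst hx
    exact ⟨_, hT _ j _ hz, .refl⟩
  | @head x' y' h1 h2 ih =>
    subst hx
    by_cases hcC : c ∈ C
    · exact ⟨.copy j c, hCT (by simpa using hcC), .refl⟩
    have hcR := hn.family (notMem_copies_of_mem hAC) ⟨z, hz, .head h1 h2⟩ hnc (Or.inl rfl)
      (by simpa using hcC)
    cases y' with
    | y => exact absurd h1 unionGraph_not_adj_y
    | copy k v =>
      obtain ⟨rfl, h3⟩ := h1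
      have hv := mem_of_moralReach hAC hy hcR ⟨z, hz, h2⟩ (Or.inr ⟨rfl, h3⟩)
      exact (ih hcR (Or.inr ⟨rfl, h3⟩) rfl).parent ⟨rfl, hI v hv _ _ _ h3⟩

/-- A chain from `[A]` never visits `y` and uses only families with child in `I`, so it can be
transported family by family. -/
theorem moralReach_copy (hI : ∀ v ∈ I, ∀ i j u, (E i).Adj u v → (E j).Adj u v)
    (hAC : Disjoint A C)
    (hy : ¬ MoralReach (unionGraph E I) (copies K A) T (copies K C) .y)
    (hT : ∀ i j v, Node.copy i v ∈ T → Node.copy j v ∈ T) (hCT : copies K C ⊆ T)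
    {i : Fin K} (j : Fin K) {v : V}
    (hv : MoralReach (unionGraph E I) (copies K A) T (copies K C) (.copy i v)) :
    MoralReach (unionGraph E I) (copies K A) T (copies K C) (.copy j v) := by
  obtain ⟨a, ha, h⟩ := hv
  generalize hx : Node.copy i v = x at h
  induction h generalizing i v with
  | refl =>
    subst hx
    exact ⟨.copy j v, by simpa using ha, .refl⟩
  | @tail x' y' h1 h2 ih =>
    subst hx
    obtain ⟨h3, h4, c, hc, h5, h6⟩ := h2
    cases c with
    | y => simp at h6
    | copy k c =>
      have hR : MoralReach (unionGraph E I) (copies K A) T (copies K C) x' := ⟨a, ha, h1⟩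
      cases x' with
      | y => exact absurd hR hy
      | copy l u =>
        have hcI := mem_of_moralReach hAC hy hR hc h5
        have hcj := isAncestorOf_copy hI hAC hy hT hCT j hR hc h5
        refine (ih rfl).family (notMem_copies_of_mem hAC) hcj ?_ ?_ (by simpa using h4)
        · simp only [Node.copy.injEq, unionGraph_adj_copy, true_and] at h5 ⊢
          exact h5.imp And.right fun h => hI c hcI _ _ _ h.2
        · simp only [Node.copy.injEq, unionGraph_adj_copy, true_and] at h6 ⊢
          exact h6.imp And.right fun h => hI c hcI _ _ _ h.2

end

/-- `S` is the moral component of `A`, `T` the children of the ancestral families meeting `S`, and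
`N j` the ancestral set in copy `j`. Transport between copies makes `S` and `T` independent of the
index `j₀`. -/
theorem exists_isSplitting [Fintype V] [DecidableEq V] (j₀ : Fin K)
    (hI : ∀ v ∈ I, ∀ i j u, (E i).Adj u v → (E j).Adj u v) (hAC : Disjoint A C)
    {T : Set (Node K V)} (hT : T = copies K A ∪ copies K B ∪ copies K C)
    (hy : ¬ MoralReach (unionGraph E I) (copies K A) T (copies K C) .y)
    (hB : ∀ b ∈ copies K B, ¬ MoralReach (unionGraph E I) (copies K A) T (copies K C) b) :
    ∃ S T N, IsSplitting E I A B C S T N := by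
  classical
  have hAT : copies K A ⊆ T := fun x hx => hT ▸ Or.inl (Or.inl hx)
  have hBT : copies K B ⊆ T := fun x hx => hT ▸ Or.inl (Or.inr hx)
  have hCT : copies K C ⊆ T := fun x hx => hT ▸ Or.inr hx
  have hTT : ∀ i j v, Node.copy i v ∈ T → Node.copy j v ∈ T := by simp [hT]
  have hAZ := notMem_copies_of_mem (K := K) hAC
  clear hT
  set R := MoralReach (unionGraph E I) (copies K A) T (copies K C) with hR
  have hcopy : ∀ i j v, R (.copy i v) → R (.copy j v) := fun i j v =>
    moralReach_copy hI hAC hy hTT hCT j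
  set Q : Fin K → V → Prop := fun j c => IsAncestorOf (unionGraph E I) (.copy j c) T ∧
    ∃ u, R (.copy j u) ∧ (u = c ∨ (E j).Adj u c) with hQ
  have conv : ∀ {j u c}, (u = c ∨ (E j).Adj u c) →
      ((Node.copy j u = .copy j c) ∨ (unionGraph E I).Adj (.copy j u) (.copy j c)) := by
    intro j u c h
    simpa using h
  have hQI : ∀ j c, Q j c → c ∈ I := fun j c ⟨hc, u, hu, huc⟩ =>
    mem_of_moralReach hAC hy hu hc (conv huc)
  have hQcopy : ∀ i j c, Q i c → Q j c := fun i j c h =>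
    let ⟨hc, u, hu, huc⟩ := h
    ⟨isAncestorOf_copy hI hAC hy hTT hCT j hu hc (conv huc), u, hcopy i j u hu,
      huc.imp_right (hI c (hQI i c h) _ _ _)⟩
  have hQfam : ∀ j c w, Q j c → (w = c ∨ (E j).Adj w c) → R (.copy j w) ∨ w ∈ C := by
    rintro j c w ⟨hc, u, hu, huc⟩ hw
    by_cases hwC : w ∈ C
    · exact Or.inr hwC
    · exact Or.inl (hu.family hAZ hc (conv huc) (conv hw) (by simpa using hwC))
  have hAR : ∀ j, ∀ v ∈ A, R (.copy j v) := fun j v hv => ⟨.copy j v, by simpa using hv, .refl⟩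
  refine ⟨Finset.univ.filter fun v => R (.copy j₀ v), Finset.univ.filter fun v => Q j₀ v,
    fun j => Finset.univ.filter fun v => IsAncestorOf (unionGraph E I) (.copy j v) T, ?_⟩
  constructor
  case disjoint_right =>
    rw [Finset.disjoint_left]
    intro v hv hvB
    exact hB (.copy j₀ v) (by simpa using hvB) (by simpa using hv)
  case disjoint_cond =>
    rw [Finset.disjoint_left]
    intro v hv hvC
    simp only [Finset.mem_filter, Finset.mem_univ, true_and] at hv
    exact hv.notMem hAZ (by simpa using hvC)
  all_goals simp only [Finset.subset_iff, Finset.mem_filter, Finset.mem_univ, true_and]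
  · exact fun j v hv => ⟨_, hAT (copy_mem_copies.mpr hv), .refl⟩
  · exact fun j v hv => ⟨_, hBT (copy_mem_copies.mpr hv), .refl⟩
  · exact fun j v hv => ⟨_, hCT (copy_mem_copies.mpr hv), .refl⟩
  · exact fun j u v hv huv => hv.parent ⟨rfl, huv⟩
  · exact fun j v hv => (hcopy _ j _ hv).isAncestorOf hAT
  · exact fun j v hv => (hQcopy _ j _ hv).1
  · exact fun v hv => hAR _ v hv
  · exact fun v hv => hQI _ v hv
  · exact fun v hv => hQfam _ v v hv (Or.inl rfl)
  · exact fun j v hv u huv =>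
      (hQfam j v u (hQcopy _ j _ hv) (Or.inr huv)).imp_left (hcopy _ _ _)
  · exact fun j v hv hvT hvS => hvT (hQcopy j _ _ ⟨hv, v, hcopy _ j _ hvS, Or.inl rfl⟩)
  · exact fun j v hv hvT u huv huS =>
      hvT (hQcopy j _ _ ⟨hv, u, hcopy _ j _ huS, Or.inr huv⟩)

/-- If `y` is joined to both `A` and `B`, then `A` is joined to `B`. -/
theorem exists_isSplitting_of_not_moral [Fintype V] [DecidableEq V] (j₀ : Fin K)
    (hI : ∀ v ∈ I, ∀ i j u, (E i).Adj u v → (E j).Adj u v) (hAC : Disjoint A C)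
    (hBC : Disjoint B C)
    (h : ∀ a ∈ copies K A, ∀ b ∈ copies K B, ¬ Relation.ReflTransGen
      (Moral (unionGraph E I) (copies K A ∪ copies K B ∪ copies K C) (copies K C)) a b) :
    (∃ S T N, IsSplitting E I A B C S T N) ∨ ∃ S T N, IsSplitting E I B A C S T N := by
  set T := copies K A ∪ copies K B ∪ copies K C with hT
  have hsymm : ∀ {a b}, Relation.ReflTransGen (Moral (unionGraph E I) T (copies K C)) a b →
      Relation.ReflTransGen (Moral (unionGraph E I) T (copies K C)) b a := fun h =>
    haveI : Std.Symm (Moral (unionGraph E I) T (copies K C)) := ⟨fun _ _ h => h.symm⟩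
    Relation.ReflTransGen.stdSymm.symm _ _ h
  by_cases hy : MoralReach (unionGraph E I) (copies K A) T (copies K C) .y
  · obtain ⟨a, ha, hay⟩ := hy
    refine Or.inr (exists_isSplitting j₀ hI hBC (hT.trans (by rw [Set.union_comm (copies K A)]))
      ?_ ?_)
    · rintro ⟨b, hb, hby⟩
      exact h a ha b hb (hay.trans (hsymm hby))
    · rintro a' ha' ⟨b, hb, hba⟩
      exact h a' ha' b hb (hsymm hba)
  · exact Or.inl (exists_isSplitting j₀ hI hAC hT hy
      fun b hb ⟨a, ha, hab⟩ => h a ha b hb hab)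

end Splitting

/-! ### Conditional independence from a factorization of the density -/

section Criterion

variable {Ω : Type*} {m mΩ : MeasurableSpace Ω} {P ν : Measure Ω}

/-- `ρ` is a density of `P` on `m` only, so the two measures are compared after trimming to `m`. -/
theorem setLIntegral_eq_setLIntegral_mul_of_density (hm : m ≤ mΩ) {ρ : Ω → ℝ≥0∞}
    (hρ : Measurable[m] ρ) (hP : ∀ U, MeasurableSet[m] U → P U = ∫⁻ x in U, ρ x ∂ν)
    {g : Ω → ℝ≥0∞} (hg : Measurable[m] g) {U : Set Ω} (hU : MeasurableSet[m] U) :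
    ∫⁻ x in U, g x ∂P = ∫⁻ x in U, ρ x * g x ∂ν := by
  have htrim : P.trim hm = (ν.withDensity ρ).trim hm := by
    refine @Measure.ext _ m _ _ fun s hs => ?_
    rw [trim_measurableSet_eq hm hs, trim_measurableSet_eq hm hs, withDensity_apply _ (hm _ hs),
      hP s hs]
  have hind : Measurable[m] (U.indicator g) := hg.indicator hU
  rw [← lintegral_indicator (hm _ hU), ← lintegral_trim hm hind, htrim, lintegral_trim hm hind,
    lintegral_indicator (hm _ hU), restrict_withDensity (hm _ hU),
    lintegral_withDensity_eq_lintegral_mul _ (hρ.mono hm le_rfl) (hg.mono hm le_rfl)]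
  rfl

/-- If `P` has density `ρ` and `P (E ∩ ·)` has density `φ` with respect to `ν` on `m`, then the
conditional probability of `E` given `m` is `φ / ρ`. -/
theorem condExp_indicator_eq_of_density [IsFiniteMeasure P] (hm : m ≤ mΩ) {ρ φ : Ω → ℝ≥0∞}
    (hρ : Measurable[m] ρ) (hφ : Measurable[m] φ) (hle : φ ≤ ρ)
    (hP : ∀ U, MeasurableSet[m] U → P U = ∫⁻ x in U, ρ x ∂ν)
    {E : Set Ω} (hE : MeasurableSet E)
    (hPE : ∀ U, MeasurableSet[m] U → P (E ∩ U) = ∫⁻ x in U, φ x ∂ν) :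
    P⟦E | m⟧ =ᵐ[P] fun x => (φ x / ρ x).toReal := by
  have hq : Measurable[m] fun x => φ x / ρ x := hφ.div hρ
  have hq1 : ∀ x, φ x / ρ x ≤ 1 := fun x => ENNReal.div_le_of_le_mul (by simpa using hle x)
  have htop : ∀ᵐ x ∂ν, ρ x < ∞ := by
    refine ae_lt_top (hρ.mono hm le_rfl) ?_
    have := hP Set.univ MeasurableSet.univ
    rw [Measure.restrict_univ] at this
    rw [← this]
    exact measure_ne_top _ _
  have hint : ∀ U, MeasurableSet[m] U → ∫⁻ x in U, φ x / ρ x ∂P = P (E ∩ U) := by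
    intro U hU
    rw [setLIntegral_eq_setLIntegral_mul_of_density hm hρ hP hq hU, hPE U hU]
    refine lintegral_congr_ae (ae_restrict_of_ae ?_)
    filter_upwards [htop] with x hx
    -- Where `ρ` vanishes, so does `φ ≤ ρ`, and `0 / 0 = 0` is harmless.
    exact ENNReal.mul_div_cancel' (fun h => le_antisymm (h ▸ hle x) zero_le)
      (fun h => absurd h hx.ne)
  have hint' : Integrable (fun x => (φ x / ρ x).toReal) P := by
    refine integrable_toReal_of_lintegral_ne_top (hq.mono hm le_rfl).aemeasurable ?_
    rw [← setLIntegral_univ, hint _ MeasurableSet.univ]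
    exact measure_ne_top _ _
  refine (ae_eq_condExp_of_forall_setIntegral_eq hm ?_ (fun _ _ _ => hint'.integrableOn)
    (fun U hU _ => ?_) ?_).symm
  · exact (integrable_const _).indicator hE
  · rw [integral_toReal (hq.mono hm le_rfl).aemeasurable
      (Filter.Eventually.of_forall fun x => (hq1 x).trans_lt ENNReal.one_lt_top), hint U hU,
      integral_indicator hE, Measure.restrict_restrict hE]
    simp [Measure.real]
  · exact (hq.ennreal_toReal).stronglyMeasurable.aestronglyMeasurable

/-- `f` and `g` are conditionally independent given `m` if, on `m`, the probability of
`f ∈ s, g ∈ t` has a density which is a product of a factor that depends on `s` and one that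
depends on `t`. -/
theorem condIndepFun_of_density [StandardBorelSpace Ω] [IsFiniteMeasure P] (hm : m ≤ mΩ)
    {β γ : Type*} [MeasurableSpace β] [MeasurableSpace γ] {f : Ω → β} {g : Ω → γ}
    (hf : Measurable f) (hg : Measurable g) (H : Set β → Ω → ℝ≥0∞) (G : Set γ → Ω → ℝ≥0∞)
    (hH : ∀ s, MeasurableSet s → Measurable[m] (H s))
    (hG : ∀ t, MeasurableSet t → Measurable[m] (G t))
    (hHle : ∀ s, H s ≤ H Set.univ) (hGle : ∀ t, G t ≤ G Set.univ)
    (hP : ∀ s t U, MeasurableSet s → MeasurableSet t → MeasurableSet[m] U →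
      P (f ⁻¹' s ∩ g ⁻¹' t ∩ U) = ∫⁻ x in U, H s x * G t x ∂ν) :
    CondIndepFun m hm f g P := by
  rw [condIndepFun_iff_condExp_inter_preimage_eq_mul hf hg]
  intro s t hs ht
  have hH1 := hH _ MeasurableSet.univ
  have hG1 := hG _ MeasurableSet.univ
  have hρ : Measurable[m] fun x => H Set.univ x * G Set.univ x := hH1.mul hG1
  have hPρ : ∀ U, MeasurableSet[m] U → P U = ∫⁻ x in U, H Set.univ x * G Set.univ x ∂ν := by
    intro U hU
    simpa using hP _ _ U MeasurableSet.univ MeasurableSet.univ hU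
  have e1 := condExp_indicator_eq_of_density hm hρ ((hH s hs).mul (hG t ht))
    (fun x => mul_le_mul' (hHle s x) (hGle t x)) hPρ ((hf hs).inter (hg ht))
    (fun U hU => hP s t U hs ht hU)
  have e2 := condExp_indicator_eq_of_density hm hρ ((hH s hs).mul hG1)
    (fun x => mul_le_mul' (hHle s x) le_rfl) hPρ (hf hs)
    (fun U hU => by simpa using hP s Set.univ U hs MeasurableSet.univ hU)
  have e3 := condExp_indicator_eq_of_density hm hρ (hH1.mul (hG t ht))
    (fun x => mul_le_mul' le_rfl (hGle t x)) hPρ (hg ht)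
    (fun U hU => by simpa using hP Set.univ t U MeasurableSet.univ ht hU)
  -- The quotients can be cancelled only where the total density is neither `0` nor `∞`, which holds
  -- `P`-almost everywhere.
  have h0 : ∀ᵐ x ∂P, H Set.univ x * G Set.univ x ≠ 0 := by
    have hU : MeasurableSet[m] {x | H Set.univ x * G Set.univ x = 0} :=
      hρ (measurableSet_singleton 0)
    have := hPρ _ hU
    rw [setLIntegral_congr_fun (g := fun _ => 0) (hm _ hU) (fun x hx => hx), lintegral_zero]
      at this
    simpa only [ae_iff, not_not] using this
  have htop : ∀ᵐ x ∂P, H Set.univ x * G Set.univ x ≠ ∞ := by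
    have hU : MeasurableSet[m] {x | H Set.univ x * G Set.univ x = ∞} :=
      hρ (measurableSet_singleton ∞)
    have h1 : ν {x | H Set.univ x * G Set.univ x = ∞} = 0 := by
      have : ∀ᵐ x ∂ν, H Set.univ x * G Set.univ x < ∞ := by
        refine ae_lt_top (hρ.mono hm le_rfl) ?_
        rw [← setLIntegral_univ, ← hPρ _ MeasurableSet.univ]
        exact measure_ne_top _ _
      simpa [ae_iff, not_lt_top_iff] using this
    have := hPρ _ hU
    rw [setLIntegral_measure_zero _ _ h1] at this
    simpa only [ae_iff, not_not] using this
  filter_upwards [e1, e2, e3, h0, htop] with x h1 h2 h3 h4 h5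
  rw [h1, h2, h3, ← ENNReal.toReal_mul]
  congr 1
  have a1 : H Set.univ x ≠ 0 := left_ne_zero_of_mul h4
  have a2 : G Set.univ x ≠ 0 := right_ne_zero_of_mul h4
  have a3 : H Set.univ x ≠ ∞ := fun h => h5 (by rw [h, ENNReal.top_mul a2])
  have a4 : G Set.univ x ≠ ∞ := fun h => h5 (by rw [h, ENNReal.mul_top a1])
  have b1 : H s x * G Set.univ x / (H Set.univ x * G Set.univ x) = H s x / H Set.univ x :=
    ENNReal.mul_div_mul_right _ _ a2 a4
  have b2 : H Set.univ x * G t x / (H Set.univ x * G Set.univ x) = G t x / G Set.univ x :=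
    ENNReal.mul_div_mul_left _ _ a1 a3
  simp only [Pi.mul_apply]
  rw [b1, b2, ENNReal.div_eq_inv_mul, ENNReal.div_eq_inv_mul, ENNReal.div_eq_inv_mul,
    ENNReal.mul_inv (Or.inl a1) (Or.inl a3)]
  ring

end Criterion

/-! ### Marginals of products of conditional densities -/

section DependsOn

variable {V : Type*} {X : V → Type*} {M : Type*} {s t : Set V}

theorem dependsOn_mul [Mul M] {f g : (∀ v, X v) → M} (hf : DependsOn f s) (hg : DependsOn g s) :
    DependsOn (fun x => f x * g x) s := fun _ _ h =>
  congrArg₂ _ (hf h) (hg h)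

theorem dependsOn_finsetProd {ι : Type*} [CommMonoid M] {J : Finset ι}
    {f : ι → (∀ v, X v) → M} (hf : ∀ i ∈ J, DependsOn (f i) s) :
    DependsOn (fun x => ∏ i ∈ J, f i x) s := fun _ _ h =>
  Finset.prod_congr rfl fun i hi => hf i hi h

theorem dependsOn_update [DecidableEq V] {f : (∀ v, X v) → M} (hf : DependsOn f s) {v : V}
    (hv : v ∉ s) (x : ∀ v, X v) (y : X v) : f (Function.update x v y) = f x :=
  hf fun _ hi => Function.update_of_ne (ne_of_mem_of_not_mem hi hv) _ _

/-- Pass from `x` to `y` through the hybrid point that follows `x` on `s` and `y` elsewhere. -/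
theorem dependsOn_inter [DecidableEq V] {f : (∀ v, X v) → M} (hs : DependsOn f s)
    (ht : DependsOn f t) : DependsOn f (s ∩ t) := by
  classical
  intro x y h
  have h1 : f x = f (s.piecewise x y) := hs fun i hi => by simp [hi]
  have h2 : f (s.piecewise x y) = f y := ht fun i hi => by
    by_cases his : i ∈ s
    · simpa [his] using h i ⟨his, hi⟩
    · simp [his]
  exact h1.trans h2

theorem dependsOn_biInter [DecidableEq V] {ι : Type*} [Finite ι] {f : (∀ v, X v) → M}
    {s : ι → Set V} (hs : ∀ i, DependsOn f (s i)) : DependsOn f (⋂ i, s i) := by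
  classical
  cases nonempty_fintype ι
  have : ∀ J : Finset ι, DependsOn f (⋂ i ∈ J, s i) := by
    intro J
    induction J using Finset.induction_on with
    | empty => simpa using dependsOn_univ f
    | insert i J _ ih =>
      rw [Finset.set_biInter_insert]
      exact dependsOn_inter (hs i) ih
  simpa using this Finset.univ

theorem dependsOn_restrict_indicator (A : Finset V) (a : Set (∀ i : A, X i)) :
    DependsOn ((A.restrict (π := X) ⁻¹' a).indicator (1 : (∀ v, X v) → ℝ≥0∞)) (A : Set V) := by
  classical
  intro x y h
  have : A.restrict (π := X) x = A.restrict (π := X) y := funext fun i => h i i.2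
  simp [Set.indicator, this]

end DependsOn

section Marginal

variable {V : Type*} [DecidableEq V] {X : V → Type*} [∀ v, MeasurableSpace (X v)]
  {μ : ∀ v, Measure (X v)} {f g : (∀ v, X v) → ℝ≥0∞}

theorem lmarginal_mul_of_dependsOn {s : Finset V} (hf : Measurable f)
    {t : Set V} (hg : DependsOn g t) (hst : ∀ v ∈ s, v ∉ t) :
    lmarginal μ s (fun x => f x * g x) = fun x => lmarginal μ s f x * g x := by
  funext x
  have : ∀ y : ∀ i : s, X i, g (Function.updateFinset x s y) = g x := fun y =>
    hg fun i hi => by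
      have : i ∉ s := fun h => hst i h hi
      simp [Function.updateFinset, this]
  simp only [lmarginal, this]
  exact lintegral_mul_const _ (hf.comp measurable_updateFinset)

theorem dependsOn_lmarginal {s : Finset V} {t : Set V} (hf : DependsOn f t) {r : Set V}
    (h : ∀ v ∈ t, v ∈ s ∨ v ∈ r) : DependsOn (lmarginal μ s f) r := by
  intro x y hxy
  simp only [lmarginal]
  refine lintegral_congr fun z => hf fun i hi => ?_
  by_cases his : i ∈ s
  · simp [Function.updateFinset, his]
  · simpa [Function.updateFinset, his] using hxy i ((h i hi).resolve_left his)

/-- A measurable function of the coordinates in `C` is measurable for the σ-algebra they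
generate. -/
theorem measurable_comap_restrict {C : Finset V} (hf : Measurable f)
    (hd : DependsOn f (C : Set V)) (x₀ : ∀ v, X v) :
    Measurable[MeasurableSpace.comap (C.restrict (π := X)) inferInstance] f := by
  have : f = (fun y => f (Function.updateFinset x₀ C y)) ∘ C.restrict (π := X) := by
    funext x
    refine hd fun i hi => ?_
    have hi' : i ∈ C := hi
    simp [Function.updateFinset, hi']
  rw [this]
  exact (hf.comp measurable_updateFinset).comp (comap_measurable _)

/-- This supplies the reference measure on the full space for `condIndepFun_of_density`: the
coordinates outside `C` are frozen at `x₀`. -/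
theorem lmarginal_eq_lintegral_map {C : Finset V} (hf : Measurable f) (x₀ : ∀ v, X v) :
    lmarginal μ C f x₀ =
      ∫⁻ x, f x ∂((Measure.pi fun i : C => μ i).map (Function.updateFinset x₀ C)) := by
  rw [lintegral_map hf measurable_updateFinset]
  rfl

/-- In a family of factors indexed by the nodes of a DAG, each integrating to one over its own
coordinate and otherwise depending on the parents only, a set `R` of nodes without children in
`N` can be integrated out. -/
theorem lmarginal_prod_union [Finite V] [∀ v, SigmaFinite (μ v)] {E : Digraph V} (hE : IsDAG E)
    {g : V → (∀ v, X v) → ℝ≥0∞} (hg : ∀ v, Measurable (g v))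
    (hd : ∀ v, DependsOn (g v) (insert v {u | E.Adj u v}))
    (h1 : ∀ v x, ∫⁻ t, g v (Function.update x v t) ∂(μ v) = 1) (R N : Finset V)
    (hRN : Disjoint R N) (hadj : ∀ v ∈ N, ∀ u ∈ R, ¬ E.Adj u v) :
    lmarginal μ R (fun x => ∏ v ∈ R ∪ N, g v x) = fun x => ∏ v ∈ N, g v x := by
  induction hn : R.card generalizing R with
  | zero =>
    rw [Finset.card_eq_zero] at hn
    subst hn
    simp
  | succ n ih =>
    have hwf : WellFounded (fun a b => Relation.TransGen E.Adj b a) := by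
      have : IsTrans V fun a b => Relation.TransGen E.Adj b a := ⟨fun _ _ _ h h' => h'.trans h⟩
      have : Std.Irrefl fun a b => Relation.TransGen E.Adj b a := ⟨fun a => hE a⟩
      exact Finite.wellFounded_of_trans_of_irrefl _
    have hne : (R : Set V).Nonempty := by
      rw [Finset.coe_nonempty, ← Finset.card_pos]
      omega
    -- The order is reversed descent, so `v` has no descendant in `R`. Its coordinate then occurs
    -- only in its own factor, which integrates to one.
    obtain ⟨v, hv, hmin⟩ := hwf.has_min _ hne
    have hv' : v ∈ R := hv
    have hvN : v ∉ N := Finset.disjoint_left.mp hRN hv'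
    have hsink : ∀ w ∈ R ∪ N, ¬ E.Adj v w := by
      intro w hw hvw
      rcases Finset.mem_union.mp hw with hw | hw
      · exact hmin w hw (.single hvw)
      · exact hadj w hw v hv' hvw
    have hunion : R ∪ N = insert v (R.erase v ∪ N) := by
      rw [← Finset.insert_union, Finset.insert_erase hv']
    have hnot : v ∉ R.erase v ∪ N := by simp [hvN]
    rw [lmarginal_erase' _ (Finset.measurable_prod _ fun v _ => hg v) hv']
    have : (fun x => ∫⁻ t, ∏ w ∈ R ∪ N, g w (Function.update x v t) ∂μ v) =
        fun x => ∏ w ∈ R.erase v ∪ N, g w x := by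
      funext x
      rw [hunion]
      have hprod : ∀ t, ∏ w ∈ R.erase v ∪ N, g w (Function.update x v t) =
          ∏ w ∈ R.erase v ∪ N, g w x := fun t => by
        refine Finset.prod_congr rfl fun w hw => dependsOn_update (hd w) ?_ x t
        rintro (rfl | h)
        · exact hnot hw
        · exact hsink w (hunion ▸ Finset.mem_insert_of_mem hw) h
      simp_rw [Finset.prod_insert hnot, hprod]
      have hm : Measurable fun t => g v (Function.update x v t) :=
        (hg v).comp (measurable_update x)
      rw [lintegral_mul_const _ hm, h1, one_mul]
    rw [this]
    exact ih _ (Finset.disjoint_of_subset_left (Finset.erase_subset _ _) hRN)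
      (fun w hw u hu => hadj w hw u (Finset.mem_of_mem_erase hu))
      (by rw [Finset.card_erase_of_mem hv', hn]; rfl)

end Marginal

/-! ### Versions of the conditional densities -/

section Versions

theorem coe_parents {V : Type*} [Fintype V] (G : Digraph V) (v : V) :
    (parents G v : Set V) = {u | G.Adj u v} := by
  ext u
  simp [parents]

variable {V : Type*} [Fintype V] {X : V → Type*} [∀ v, MeasurableSpace (X v)]
  {μ : ∀ v, Measure (X v)}

theorem ProbDensity.nonempty (p : ProbDensity μ) : Nonempty (∀ v, X v) := by
  by_contra h
  rw [not_nonempty_iff] at h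
  have := p.lintegral_eq_one
  rw [Measure.eq_zero_of_isEmpty (Measure.pi μ), lintegral_zero_measure] at this
  exact zero_ne_one this

variable [DecidableEq V] [∀ v, SigmaFinite (μ v)]

theorem ProbDensity.setLIntegral_eq_lmarginal (p : ProbDensity μ) (S : Finset V)
    {B : Set (∀ v, X v)} (hB : MeasurableSet B)
    (hd : DependsOn (B.indicator (1 : (∀ v, X v) → ℝ≥0∞)) (S : Set V)) (x₀ : ∀ v, X v) :
    ∫⁻ x in B, p.toFun x ∂(Measure.pi μ) =
      lmarginal μ S (fun x => p.marginal S x * B.indicator 1 x) x₀ := by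
  have hB' : Measurable (B.indicator (1 : (∀ v, X v) → ℝ≥0∞)) := measurable_one.indicator hB
  have hm : Measurable fun x => p.toFun x * B.indicator 1 x := p.measurable_toFun.mul hB'
  have h1 : B.indicator p.toFun = fun x => p.toFun x * B.indicator 1 x := by
    funext x
    by_cases hx : x ∈ B <;> simp [hx]
  rw [← lintegral_indicator hB, h1, lintegral_eq_lmarginal_univ x₀, ← Finset.union_compl S,
    lmarginal_union _ _ hm disjoint_compl_right,
    lmarginal_mul_of_dependsOn p.measurable_toFun hd (by simp)]
  rfl

/-- Almost surely the marginal densities are positive and finite. -/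
theorem ProbDensity.ae_marginal_ne (p : ProbDensity μ) (S : Finset V) :
    ∀ᵐ x ∂(Measure.pi μ), p.toFun x ≠ 0 → p.marginal S x ≠ 0 ∧ p.marginal S x ≠ ∞ := by
  obtain ⟨x₀⟩ := p.nonempty
  have hm : Measurable (p.marginal S) := p.measurable_toFun.lmarginal μ
  have hdep : DependsOn (p.marginal S) (S : Set V) :=
    dependsOn_lmarginal (dependsOn_univ _) (by simp [em'])
  have hind : ∀ c, DependsOn ({x | p.marginal S x = c}.indicator (1 : (∀ v, X v) → ℝ≥0∞))
      (S : Set V) := fun c x y h => by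
    simp [Set.indicator, hdep h]
  have hmeas : ∀ c, MeasurableSet {x | p.marginal S x = c} := fun c =>
    hm (measurableSet_singleton c)
  -- The mass of the cylinder where the marginal equals `c` is `c` times its reference measure. For
  -- `c = ∞` this is `0` or `∞`, and `∞` exceeds the total mass one.
  have key : ∀ c, (c = 0 ∨ c = ∞) →
      ∀ᵐ x ∂(Measure.pi μ), p.marginal S x = c → p.toFun x = 0 := by
    intro c hc
    have h1 := p.setLIntegral_eq_lmarginal S (hmeas c) (hind c) x₀
    have h2 : (fun x => p.marginal S x * {x | p.marginal S x = c}.indicator 1 x) =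
        fun x => c * {x | p.marginal S x = c}.indicator 1 x := by
      funext x
      by_cases hx : p.marginal S x = c <;> simp [Set.indicator, hx]
    have h3 : ∫⁻ x in {x | p.marginal S x = c}, p.toFun x ∂(Measure.pi μ) =
        c * lmarginal μ S ({x | p.marginal S x = c}.indicator 1) x₀ := by
      rw [h1, h2]
      simp only [lmarginal]
      exact lintegral_const_mul _
        ((measurable_one.indicator (hmeas c)).comp measurable_updateFinset)
    have h4 : ∫⁻ x in {x | p.marginal S x = c}, p.toFun x ∂(Measure.pi μ) = 0 := by
      rcases hc with rfl | rfl
      · rw [h3, zero_mul]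
      · by_cases h0 : lmarginal μ S ({x | p.marginal S x = ∞}.indicator 1) x₀ = 0
        · rw [h3, h0, mul_zero]
        · rw [ENNReal.top_mul h0] at h3
          have := setLIntegral_le_lintegral {x | p.marginal S x = ∞} p.toFun (μ := Measure.pi μ)
          rw [h3, p.lintegral_eq_one] at this
          exact absurd this (by simp)
    rw [lintegral_eq_zero_iff p.measurable_toFun] at h4
    exact (ae_restrict_iff' (hmeas c)).mp h4
  filter_upwards [key 0 (Or.inl rfl), key ∞ (Or.inr rfl)] with x h0 h1 hx
  exact ⟨fun h => hx (h0 h), fun h => hx (h1 h)⟩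

/-- A factorization does not depend on the chosen versions of the conditional densities. -/
theorem Factorizes.ae_eq_prod {G : Digraph V} (hG : IsDAG G) {p : ProbDensity μ}
    (hp : Factorizes G p) {g : V → (∀ u, X u) → ℝ≥0∞}
    (hg : ∀ v, IsCondDensity p v (parents G v) (g v)) :
    ∀ᵐ x ∂(Measure.pi μ), p.toFun x = ∏ v, g v x := by
  obtain ⟨f, hf, hpf⟩ := hp
  obtain ⟨x₀⟩ := p.nonempty
  have hgm : Measurable fun x => ∏ v, g v x :=
    Finset.measurable_prod _ fun v _ => (hg v).measurable
  -- Where `p` is nonzero, the parent marginals can be cancelled and the two versions agree;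
  -- elsewhere the bound is trivial. Equality follows since both sides integrate to one.
  have hle : p.toFun ≤ᵐ[Measure.pi μ] fun x => ∏ v, g v x := by
    have h1 := ae_all_iff.mpr fun v => p.ae_marginal_ne (parents G v)
    have h2 := ae_all_iff.mpr fun v => (hf v).marginal_eq
    have h3 := ae_all_iff.mpr fun v => (hg v).marginal_eq
    filter_upwards [hpf, h1, h2, h3] with x e1 e2 e3 e4
    by_cases hx : p.toFun x = 0
    · simp [hx]
    · rw [e1]
      refine (Finset.prod_congr rfl fun v _ => ?_).le
      have := (e3 v).symm.trans (e4 v)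
      exact (ENNReal.mul_left_inj (e2 v hx).1 (e2 v hx).2).mp this
  refine ae_eq_of_ae_le_of_lintegral_le hle (by simp [p.lintegral_eq_one]) hgm.aemeasurable ?_
  have h4 := lmarginal_prod_union hG (fun v => (hg v).measurable)
    (fun v => coe_parents G v ▸ (hg v).dependsOn) (fun v x => (hg v).lintegral_eq_one x)
    Finset.univ ∅ (Finset.disjoint_empty_right _) (by simp)
  rw [p.lintegral_eq_one, lintegral_eq_lmarginal_univ x₀]
  simp only [Finset.union_empty, Finset.prod_empty] at h4
  rw [h4]

end Versions

/-! ### Conditional independence from a splitting -/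

section Component

variable {V : Type*} [Fintype V] [DecidableEq V] {X : V → Type*} [∀ v, MeasurableSpace (X v)]
  {μ : ∀ v, Measure (X v)} [∀ v, SigmaFinite (μ v)]

/-- The integral of a product of functions of `x_A`, `x_B` and `x_C` against a product of
conditional densities, where `N` is ancestral, `S` contains `A`, and the families with child in
`T` are contained in `S ∪ C` while the other families in `N` avoid `S`. -/
theorem lintegral_mul_prod_eq_lmarginal {E : Digraph V} (hE : IsDAG E)
    {g : V → (∀ v, X v) → ℝ≥0∞} (hg : ∀ v, Measurable (g v))
    (hd : ∀ v, DependsOn (g v) (insert v {u | E.Adj u v}))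
    (h1 : ∀ v x, ∫⁻ t, g v (Function.update x v t) ∂(μ v) = 1)
    {A B C S T N : Finset V} (hAN : A ⊆ N) (hBN : B ⊆ N) (hCN : C ⊆ N)
    (hN : ∀ u v, v ∈ N → E.Adj u v → u ∈ N) (hSN : S ⊆ N) (hTN : T ⊆ N) (hAS : A ⊆ S)
    (hSB : Disjoint S B) (hSC : Disjoint S C)
    (hT : ∀ v ∈ T, (v ∈ S ∨ v ∈ C) ∧ ∀ u, E.Adj u v → u ∈ S ∨ u ∈ C)
    (hNT : ∀ v ∈ N, v ∉ T → v ∉ S ∧ ∀ u, E.Adj u v → u ∉ S)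
    {α β κ : (∀ v, X v) → ℝ≥0∞} (hα : Measurable α) (hβ : Measurable β) (hκ : Measurable κ)
    (hαA : DependsOn α (A : Set V)) (hβB : DependsOn β (B : Set V))
    (hκC : DependsOn κ (C : Set V)) (x₀ : ∀ v, X v) :
    ∫⁻ x, (∏ v, g v x) * (α x * β x * κ x) ∂(Measure.pi μ) =
      lmarginal μ C (fun z => lmarginal μ S (fun x => α x * ∏ v ∈ T, g v x) z *
        lmarginal μ ((N \ S) \ C) (fun x => β x * ∏ v ∈ N \ T, g v x) z * κ z) x₀ := by
  have hprod : ∀ J : Finset V, Measurable fun x => ∏ v ∈ J, g v x := fun J =>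
    Finset.measurable_prod _ fun v _ => hg v
  have hαβκ : DependsOn (fun x => α x * β x * κ x) (N : Set V) :=
    dependsOn_mul (dependsOn_mul (hαA.mono (by exact_mod_cast hAN))
      (hβB.mono (by exact_mod_cast hBN))) (hκC.mono (by exact_mod_cast hCN))
  have hm : Measurable fun x => α x * β x * κ x := (hα.mul hβ).mul hκ
  -- `N` is closed under parents, so the nodes outside it have no children in it.
  have hNc : lmarginal μ Nᶜ (fun x => ∏ v, g v x) = fun x => ∏ v ∈ N, g v x := by
    have := lmarginal_prod_union hE hg hd h1 Nᶜ N disjoint_compl_left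
      (fun v hv u hu huv => Finset.mem_compl.mp hu (hN u v hv huv))
    rwa [Finset.union_comm, Finset.union_compl] at this
  set R := (N \ S) \ C with hR
  have hNeq : N = C ∪ (S ∪ R) := by
    ext v
    simp only [hR, Finset.mem_union, Finset.mem_sdiff]
    constructor
    · tauto
    · rintro (h | h | h)
      exacts [hCN h, hSN h, h.1.1]
  have hdisj1 : Disjoint C (S ∪ R) := by
    rw [Finset.disjoint_union_right]
    exact ⟨hSC.symm, Finset.disjoint_sdiff⟩
  have hdisj2 : Disjoint S R :=
    Finset.disjoint_of_subset_right Finset.sdiff_subset Finset.disjoint_sdiff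
  have hHm : Measurable fun x => α x * ∏ v ∈ T, g v x := hα.mul (hprod T)
  have hGm : Measurable fun x => β x * ∏ v ∈ N \ T, g v x := hβ.mul (hprod _)
  have hHd : DependsOn (fun x => α x * ∏ v ∈ T, g v x) ((S ∪ C : Finset V) : Set V) := by
    refine dependsOn_mul (hαA.mono ?_) (dependsOn_finsetProd fun v hv => (hd v).mono ?_)
    · exact_mod_cast hAS.trans Finset.subset_union_left
    · rintro u (rfl | hu)
      · simpa using (hT u hv).1
      · simpa using (hT v hv).2 u hu
  have hGd : DependsOn (fun x => β x * ∏ v ∈ N \ T, g v x) ((N \ S : Finset V) : Set V) := by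
    refine dependsOn_mul (hβB.mono fun v hv => ?_)
      (dependsOn_finsetProd fun v hv => (hd v).mono ?_)
    · exact Finset.mem_sdiff.mpr ⟨hBN hv, Finset.disjoint_right.mp hSB hv⟩
    · rw [Finset.mem_sdiff] at hv
      rintro u (rfl | hu)
      · exact Finset.mem_sdiff.mpr ⟨hv.1, (hNT u hv.1 hv.2).1⟩
      · exact Finset.mem_sdiff.mpr ⟨hN u v hv.1 hu, (hNT v hv.1 hv.2).2 u hu⟩
  have hGd' : DependsOn (lmarginal μ R fun x => β x * ∏ v ∈ N \ T, g v x) (C : Set V) := by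
    refine dependsOn_lmarginal hGd fun v hv => ?_
    have : v ∈ N \ S := hv
    simp only [hR, Finset.mem_sdiff, Finset.mem_coe] at this ⊢
    tauto
  have hRSC : ∀ v ∈ R, v ∉ ((S ∪ C : Finset V) : Set V) := by
    intro v hv
    simp only [hR, Finset.mem_sdiff] at hv
    simp [hv.1.2, hv.2]
  have hSC' : ∀ v ∈ S, v ∉ (C : Set V) := fun v hv => by
    simpa using Finset.disjoint_left.mp hSC hv
  have hrearr : (fun x => (∏ v ∈ N, g v x) * (α x * β x * κ x)) =
      fun x => (β x * ∏ v ∈ N \ T, g v x) * ((α x * ∏ v ∈ T, g v x) * κ x) := by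
    funext x
    rw [← Finset.prod_sdiff hTN]
    ring
  have hFm : Measurable fun x => (∏ v, g v x) * (α x * β x * κ x) := (hprod _).mul hm
  have hFm' : Measurable fun x => (β x * ∏ v ∈ N \ T, g v x) * ((α x * ∏ v ∈ T, g v x) * κ x) :=
    hGm.mul (hHm.mul hκ)
  have e1 : lmarginal μ Finset.univ (fun x => (∏ v, g v x) * (α x * β x * κ x)) =
      lmarginal μ N (fun x => (β x * ∏ v ∈ N \ T, g v x) * ((α x * ∏ v ∈ T, g v x) * κ x)) := by
    rw [← congrArg (fun J => lmarginal μ J) (Finset.union_compl N),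
      lmarginal_union _ _ hFm disjoint_compl_right,
      lmarginal_mul_of_dependsOn (hprod _) hαβκ (by simp), hNc, hrearr]
  -- `R` is integrated out first, touching only the factor of `β`; what remains of it depends on `C`
  -- alone and passes through the integral over `S`.
  rw [lintegral_eq_lmarginal_univ x₀, e1, congrArg (fun J => lmarginal μ J) hNeq,
    lmarginal_union _ _ hFm' hdisj1, lmarginal_union _ _ hFm' hdisj2,
    lmarginal_mul_of_dependsOn hGm
      (dependsOn_mul hHd (hκC.mono (by exact_mod_cast Finset.subset_union_right))) hRSC]
  have hcomm : (fun x => lmarginal μ R (fun x => β x * ∏ v ∈ N \ T, g v x) x *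
      ((α x * ∏ v ∈ T, g v x) * κ x)) = fun x => (α x * ∏ v ∈ T, g v x) *
        (lmarginal μ R (fun x => β x * ∏ v ∈ N \ T, g v x) x * κ x) := by
    funext x
    ring
  rw [hcomm, lmarginal_mul_of_dependsOn hHm (dependsOn_mul hGd' hκC) hSC']
  simp only [mul_assoc]

end Component

/-! ### Deleting edges that the common conditional densities do not see -/

section Reduced

variable {V : Type*} {K : ℕ}

/-- The `j`-th graph, where the nodes in `I` keep only the parents they have in all graphs. -/
def reducedGraph (D : Fin K → Digraph V) (I : Set V) (j : Fin K) : Digraph V where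
  Adj u v := (D j).Adj u v ∧ (v ∈ I → ∀ i, (D i).Adj u v)

theorem isDAG_reducedGraph {D : Fin K → Digraph V} (hD : ∀ j, IsDAG (D j)) (I : Set V)
    (j : Fin K) : IsDAG (reducedGraph D I j) := fun v h =>
  hD j v (Relation.TransGen.mono (fun _ _ h => h.1) _ _ h)

end Reduced

/-! ### Assembling the components into the mixture -/

section Mixture

variable {V : Type*} [Fintype V] [DecidableEq V] {X : V → Type*} [∀ v, MeasurableSpace (X v)]
  {μ : ∀ v, Measure (X v)} {K : ℕ}

/-- The factor `H` is built from `T ⊆ I` and is common to all components, so the mixture weights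
enter only the other factor and the sum is again a product. -/
theorem condIndepCoord_mixture_of_isSplitting [∀ v, StandardBorelSpace (X v)]
    [∀ v, SigmaFinite (μ v)] {E : Fin K → Digraph V} (hE : ∀ j, IsDAG (E j)) {I : Set V}
    {p : Fin K → ProbDensity μ} (pJ : PMF (Fin K)) {g : Fin K → V → (∀ v, X v) → ℝ≥0∞}
    (hg : ∀ j v, Measurable (g j v))
    (hd : ∀ j v, DependsOn (g j v) (insert v {u | (E j).Adj u v}))
    (h1 : ∀ j v x, ∫⁻ t, g j v (Function.update x v t) ∂(μ v) = 1)
    (hp : ∀ j, ∀ᵐ x ∂(Measure.pi μ), (p j).toFun x = ∏ v, g j v x)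
    (hgI : ∀ v ∈ I, ∀ i j, g i v = g j v) {A B C S T : Finset V} {N : Fin K → Finset V}
    (h : IsSplitting E I A B C S T N) :
    CondIndepCoord (mixture pJ p).law A B C := by
  obtain ⟨j₀⟩ : Nonempty (Fin K) := ⟨pJ.support_nonempty.some⟩
  obtain ⟨x₀⟩ := (p j₀).nonempty
  set r : ∀ J : Finset V, (∀ v, X v) → ∀ v : J, X v := fun J => J.restrict (π := X) with hr
  have hrm : ∀ J, Measurable (r J) := fun J => Finset.measurable_restrict J
  set H : Set (∀ v : A, X v) → (∀ v, X v) → ℝ≥0∞ := fun s =>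
    lmarginal μ S (fun x => (r A ⁻¹' s).indicator 1 x * ∏ v ∈ T, g j₀ v x) with hH
  set G : Fin K → Set (∀ v : B, X v) → (∀ v, X v) → ℝ≥0∞ := fun j t =>
    lmarginal μ ((N j \ S) \ C) (fun x => (r B ⁻¹' t).indicator 1 x * ∏ v ∈ N j \ T, g j v x)
    with hG
  have hprod : ∀ j J, Measurable fun x => ∏ v ∈ J, g j v x := fun j J =>
    Finset.measurable_prod _ fun v _ => hg j v
  have hind : ∀ J s, MeasurableSet s →
      Measurable ((r J ⁻¹' s).indicator (1 : (∀ v, X v) → ℝ≥0∞)) := fun J s hs =>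
    measurable_one.indicator (hrm J hs)
  have hHm : ∀ s, MeasurableSet s → Measurable (H s) := fun s hs =>
    ((hind A s hs).mul (hprod j₀ T)).lmarginal μ
  have hGm : ∀ j t, MeasurableSet t → Measurable (G j t) := fun j t ht =>
    ((hind B t ht).mul (hprod j (N j \ T))).lmarginal μ
  have hHd : ∀ s, DependsOn (H s) (C : Set V) := fun s => by
    refine dependsOn_lmarginal (t := (S ∪ C : Finset V)) (dependsOn_mul
      ((dependsOn_restrict_indicator A s).mono ?_)
      (dependsOn_finsetProd fun v hv => (hd j₀ v).mono ?_)) (by simp)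
    · exact_mod_cast h.left_subset.trans Finset.subset_union_left
    · rintro u (rfl | hu)
      · simpa using h.child_mem _ hv
      · simpa using h.child_parent_mem _ _ hv u hu
  have hGd : ∀ j t, DependsOn (G j t) (C : Set V) := fun j t => by
    refine dependsOn_lmarginal (t := (N j \ S : Finset V)) (dependsOn_mul
      ((dependsOn_restrict_indicator B t).mono fun v hv => ?_)
      (dependsOn_finsetProd fun v hv => (hd j v).mono ?_)) fun v hv => ?_
    · exact Finset.mem_sdiff.mpr
        ⟨h.subset_right j hv, Finset.disjoint_right.mp h.disjoint_right hv⟩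
    · rw [Finset.mem_sdiff] at hv
      rintro u (rfl | hu)
      · exact Finset.mem_sdiff.mpr ⟨hv.1, h.notMem_side j _ hv.1 hv.2⟩
      · exact Finset.mem_sdiff.mpr
          ⟨h.parent_mem j u v hv.1 hu, h.parent_notMem_side j v hv.1 hv.2 u hu⟩
    · have : v ∈ N j \ S := hv
      simp only [Finset.mem_sdiff, Finset.mem_coe] at this ⊢
      tauto
  have hle : ∀ (J : Finset V) (s : Set (∀ v : J, X v)),
      (r J ⁻¹' s).indicator (1 : (∀ v, X v) → ℝ≥0∞) ≤ (r J ⁻¹' Set.univ).indicator 1 :=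
    fun J s => Set.indicator_le_indicator_of_subset (Set.preimage_mono (Set.subset_univ s))
      fun _ => zero_le
  refine condIndepFun_of_density
    (ν := (Measure.pi fun i : C => μ i).map (Function.updateFinset x₀ C)) _ (hrm A) (hrm B)
    H (fun t x => ∑ j, pJ j * G j t x)
    (fun s hs => measurable_comap_restrict (hHm s hs) (hHd s) x₀)
    (fun t ht => measurable_comap_restrict
      (Finset.measurable_sum _ fun j _ => (hGm j t ht).const_mul _) (fun x y hxy =>
        Finset.sum_congr rfl fun j _ => by rw [hGd j t hxy]) x₀)
    (fun s => lmarginal_mono fun x => mul_le_mul_left (hle A s x) _)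
    (fun t x => Finset.sum_le_sum fun j _ => mul_le_mul_right
      (lmarginal_mono (fun x => mul_le_mul_left (hle B t x) _) x) _) ?_
  rintro s t _ hs ht ⟨u, hu, rfl⟩
  have hmeas : MeasurableSet (r A ⁻¹' s ∩ r B ⁻¹' t ∩ r C ⁻¹' u) :=
    ((hrm A hs).inter (hrm B ht)).inter (hrm C hu)
  have hFm : Measurable fun x => (r A ⁻¹' s).indicator (1 : (∀ v, X v) → ℝ≥0∞) x *
      (r B ⁻¹' t).indicator (1 : (∀ v, X v) → ℝ≥0∞) x *
      (r C ⁻¹' u).indicator (1 : (∀ v, X v) → ℝ≥0∞) x :=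
    ((hind A s hs).mul (hind B t ht)).mul (hind C u hu)
  have hcomp : ∀ j, ∫⁻ x in r A ⁻¹' s ∩ r B ⁻¹' t ∩ r C ⁻¹' u, (p j).toFun x ∂(Measure.pi μ) =
      lmarginal μ C (fun x => H s x * G j t x * (r C ⁻¹' u).indicator 1 x) x₀ := by
    intro j
    have e := lintegral_mul_prod_eq_lmarginal (hE j) (hg j) (hd j) (h1 j) (h.subset_left j)
      (h.subset_right j) (h.subset_cond j) (h.parent_mem j) (h.side_subset j) (h.child_subset j)
      h.left_subset h.disjoint_right h.disjoint_cond
      (fun v hv => ⟨h.child_mem v hv, h.child_parent_mem j v hv⟩)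
      (fun v hv hvT => ⟨h.notMem_side j v hv hvT, h.parent_notMem_side j v hv hvT⟩)
      (hind A s hs) (hind B t ht) (hind C u hu) (dependsOn_restrict_indicator A s)
      (dependsOn_restrict_indicator B t) (dependsOn_restrict_indicator C u) x₀
    have hT : (fun x => (r A ⁻¹' s).indicator (1 : (∀ v, X v) → ℝ≥0∞) x * ∏ v ∈ T, g j v x) =
        fun x => (r A ⁻¹' s).indicator 1 x * ∏ v ∈ T, g j₀ v x := by
      funext x
      rw [Finset.prod_congr rfl fun v hv => congrFun (hgI v (h.invariant v hv) j j₀) x]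
    rw [hT] at e
    rw [← e, ← lintegral_indicator hmeas]
    refine lintegral_congr_ae ?_
    filter_upwards [hp j] with x hx
    rw [← hx]
    by_cases h1 : x ∈ r A ⁻¹' s <;> by_cases h2 : x ∈ r B ⁻¹' t <;>
      by_cases h3 : x ∈ r C ⁻¹' u <;> simp only [Set.indicator, Set.mem_inter_iff, h1, h2, h3] <;>
      simp
  have hHGm : ∀ j, Measurable fun x => H s x * G j t x * (r C ⁻¹' u).indicator 1 x := fun j =>
    ((hHm s hs).mul (hGm j t ht)).mul (hind C u hu)
  rw [ProbDensity.law, withDensity_apply _ hmeas]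
  simp only [mixture, jointDensity]
  rw [lintegral_finsetSum _ fun j _ => (p j).measurable_toFun.const_mul _,
    ← lintegral_indicator (hrm C hu)]
  simp_rw [lintegral_const_mul _ (p _).measurable_toFun, hcomp,
    lmarginal_eq_lintegral_map (hHGm _) x₀, ← lintegral_const_mul _ (hHGm _)]
  rw [← lintegral_finsetSum _ fun j _ => (hHGm j).const_mul _]
  refine lintegral_congr fun x => ?_
  by_cases hx : x ∈ r C ⁻¹' u
  · simp only [Set.indicator_of_mem hx, Pi.one_apply, mul_one, Finset.mul_sum]
    exact Finset.sum_congr rfl fun j _ => by ring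
  · simp [Set.indicator_of_notMem hx]

theorem mixtureDAG_asymm {D : Fin K → Digraph V} (hD : ∀ j, IsDAG (D j))
    (p : Fin K → ProbDensity μ) (m n : Node K V) (h : (mixtureDAG D p).Adj m n) :
    ¬ (mixtureDAG D p).Adj n m := by
  intro h'
  match m, n with
  | .copy i u, .copy j v =>
    obtain ⟨rfl, h⟩ := h
    exact hD _ u (.tail (.single h) h'.2)
  | .y, .copy _ _ => exact h'
  | .copy _ _, .y => exact h
  | .y, .y => exact h

/-- By `Moral.mono`, moral chains in the reduced graph are also chains in the mixture DAG, which
d-separation excludes. -/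
theorem unionGraph_reducedGraph_le (D : Fin K → Digraph V) (p : Fin K → ProbDensity μ)
    (m n : Node K V)
    (h : (unionGraph (reducedGraph D (invariantNodes D p)) (invariantNodes D p)).Adj m n) :
    (mixtureDAG D p).Adj m n := by
  match m, n with
  | .copy i u, .copy j v => exact ⟨h.1, h.2.1⟩
  | .y, .copy _ _ => exact h
  | .copy _ _, .y => exact h
  | .y, .y => exact h

end Mixture

end MixtureDAG

theorem mainTheorem1 {V : Type*} [Fintype V] [DecidableEq V]
    {X : V → Type*} [∀ v, MeasurableSpace (X v)] [∀ v, StandardBorelSpace (X v)]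
    (μ : ∀ v, Measure (X v)) [∀ v, SigmaFinite (μ v)]
    {K : ℕ} (D : Fin K → Digraph V) (hD : ∀ j, IsDAG (D j))
    (p : Fin K → ProbDensity μ) (hp : ∀ j, Factorizes (D j) (p j))
    (pJ : PMF (Fin K))
    (A B C : Finset V) (hAB : Disjoint A B) (hAC : Disjoint A C) (hBC : Disjoint B C)
    (hsep : DSeparated (mixtureDAG D p) (copies K A) (copies K B) (copies K C)) :
    CondIndepCoord (mixture pJ p).law A B C := by
  classical
  set I := invariantNodes D p with hI
  obtain ⟨j₀⟩ : Nonempty (Fin K) := ⟨pJ.support_nonempty.some⟩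
  -- The versions in the given factorizations may differ at invariant nodes; there they are replaced
  -- by the common one, which `Factorizes.ae_eq_prod` permits.
  have hex : ∃ g : Fin K → V → (∀ u, X u) → ℝ≥0∞,
      (∀ j v, IsCondDensity (p j) v (parents (D j) v) (g j v)) ∧
      ∀ v ∈ I, ∀ i j, g i v = g j v := by
    choose f hf _ using hp
    choose c hc using fun v : I => v.2
    refine ⟨fun j v => if hv : v ∈ I then c ⟨v, hv⟩ else f j v, fun j v => ?_,
      fun v hv i j => by simp [hv]⟩
    by_cases hv : v ∈ I
    · simpa [hv] using hc ⟨v, hv⟩ j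
    · simpa [hv] using hf j v
  obtain ⟨g, hg, hgI⟩ := hex
  have hdep : ∀ j v, DependsOn (g j v) (insert v {u | (reducedGraph D I j).Adj u v}) := by
    intro j v
    by_cases hv : v ∈ I
    -- Being a version in every component, the common function depends only on `v` and the
    -- intersection of its parent sets.
    · have h1 : ∀ i, DependsOn (g j v) (insert v {u | (D i).Adj u v}) := fun i => by
        rw [hgI v hv j i, ← coe_parents]
        exact (hg i v).dependsOn
      refine (dependsOn_biInter h1).mono fun u hu => ?_
      rw [Set.mem_iInter] at hu
      by_cases huv : u = v
      · exact Or.inl huv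
      · have h2 : ∀ i, (D i).Adj u v := fun i => (hu i).resolve_left huv
        exact Or.inr ⟨h2 j, fun _ => h2⟩
    · refine (hg j v).dependsOn.mono (Set.insert_subset_insert ?_)
      rw [coe_parents]
      exact fun u hu => ⟨hu, fun h => absurd h hv⟩
  have hmain : ∀ {A B : Finset V},
      (∃ S T N, IsSplitting (reducedGraph D I) I A B C S T N) →
      CondIndepCoord (mixture pJ p).law A B C := fun ⟨S, T, N, h⟩ =>
    condIndepCoord_mixture_of_isSplitting (isDAG_reducedGraph hD I) pJ
      (fun j v => (hg j v).measurable) hdep (fun j v => (hg j v).lintegral_eq_one)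
      (fun j => (hp j).ae_eq_prod (hD j) (hg j)) hgI h
  refine (exists_isSplitting_of_not_moral (E := reducedGraph D I) j₀
    (fun v hv i j u h => ⟨h.2 hv j, h.2⟩) hAC hBC fun a ha b hb hab => ?_).elim hmain
    fun h => (hmain h).symm
  exact hsep.not_moral (mixtureDAG_asymm hD p) ha hb
    (Relation.ReflTransGen.mono (fun _ _ h => h.mono (unionGraph_reducedGraph_le D p)) _ _ hab)
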